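/- **Setting.** There are $A$ arms and $D$ objectives, $\mathcal A=\{1,\dots,A\}$, $\mathcal D=\{1,\dots,D\}$. Arm $a$ has expected reward vector $\boldsymbol\mu_a=(\mu_a^1,\dots,\mu_a^D)\in\mathbb R^D$ and a noise distribution $\nu_a$ on $\mathbb R^D$ whose coordinates $\kappa^i$ have mean zero and are 1-sub-Gaussian, $\mathbb E[e^{\lambda\kappa^i}]\le e^{\lambda^2/2}$ for all $\lambda\in\mathbb R$ (they may be dependent). In round $t=1,2,\dots$ the learner selects an arm $a(t)$ and observes $r^i(t)=\mu^i_{a(t)}+\kappa^i(t)$, $i\in\mathcal D$, where, given $a(t)=a$, the noise vector $\kappa(t)$ has law $\nu_a$ independently of the past. A vector $x$ dominates $y$ in the first $i$ objectives if $x$ and $y$ differ in one of the first $i$ coordinates and $x^j>y^j$ for the first such coordinate $j$. Let $\mathcal A_*^i$ be the set of arms $a$ such that no $\boldsymbol\mu_{a'}$ dominates $\boldsymbol\mu_a$ in the first $i$ objectives, let $\mathcal A_*^0=\mathcal A$, and $\mathcal S_*^i=\mathcal A_*^{i-1}\setminus\mathcal A_*^i$. Let $*\in\mathcal A_*^D$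 be an arm that is lexicographic optimal in all objectives, $\Delta_a^i=\mu_*^i-\mu_a^i$, and $\Delta_{\min}^i=\min_{a\in\mathcal S_*^i}\Delta_a^i$ ($=\infty$ if $\mathcal S_*^i=\emptyset$). The priority-based regret in objective $i$ is $\mathrm{Reg}^i_{pb}(T)=\sum_{t=1}^T\Delta^i_{a(t)}\mathbb I\{a(t)\in\mathcal S_*^i\}$. **Algorithm NOM-LEX.** The inputs are reals $\eta_1,\dots,\eta_D$. Let $N_a(t)$ be the number of selections of arm $a$ before round $t$, and $\hat\mu_a^i(t)$ the sample mean of the rewards of arm $a$ in objective $i$ observed before round $t$. In round $t\le A$ select arm $t$. Then, at each decision round $t$ (the first is $t=A+1$), let $$\hat{\mathcal A}_*(t)=\Big\{a\in\mathcal A:\ \forall i\in\mathcal D,\ \hat\mu_a^i(t)>\eta_i-\sqrt{4\log N_a(t)/N_a(t)}\Big\}.$$ If $\hat{\mathcal A}_*(t)\ne\emptyset$, select an arm of $\hat{\mathcal A}_*(t)$ uniformly at random, and $t+1$ is the next decision round. If $\hat{\mathcal A}_*(t)=\emptyset$, select the arms $1,2,\dots,A$ in the rounds $t,t+1,\dots,t+A-1$,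 and $t+A$ is the next decision round. **Theorem.** Suppose that $\mu_*^i-\Delta_{\min}^i<\eta_i<\mu_*^i$ for all $i\in\mathcal D$, and put $\delta_i=\mu_*^i-\eta_i$. When NOM-LEX is run with inputs $\eta_1,\dots,\eta_D$, then for all $i\in\mathcal D$ and all $T\ge 1$, $$\mathbb E[\mathrm{Reg}^i_{pb}(T)]\le\sum_{a\in\mathcal S_*^i}\left(\Big(\frac{\pi^2}{6}D+1\Big)\Delta_a^i+\frac{36\,\Delta_a^i}{\big(\max_{j\in\mathcal D}(\Delta_a^j-\delta_j)\big)^2}\log\frac{17}{\max_{j\in\mathcal D}(\Delta_a^j-\delta_j)}\right).$$ In particular, the expected priority-based regret is bounded uniformly in $T$. -/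

import Mathlib

open MeasureTheory ProbabilityTheory
open scoped BigOperators ENNReal NNReal

noncomputable section

namespace LexBandit

/-! Arms are `Fin A`, objectives are `Fin D`; `mu a i` is the expected reward of arm `a` in
objective `i`. Rounds are counted from `0`, so that round `t` here is the round `t + 1` of the
usual count, in the same way as arm `0` is the first arm and objective `0` the first objective. -/

/-- `x` lexicographically dominates `y` in the first `n` objectives: among the first `n`
coordinates there is one where they differ, and at the first such coordinate `x` is larger. -/
def LexDominates {D : ℕ} (n : ℕ) (x y : Fin D → ℝ) : Prop :=
  ∃ j : Fin D, (j : ℕ) < n ∧ (∀ k : Fin D, k < j → x k = y k) ∧ y j < x j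

/-- The set of lexicographic optimal arms in the first `n` objectives. For `n = 0` it is the set
of all arms, for `n = D` the set of arms that are lexicographic optimal in all objectives. -/
def lexOptimal {A D : ℕ} (mu : Fin A → Fin D → ℝ) (n : ℕ) : Set (Fin A) :=
  {a | ∀ a' : Fin A, ¬ LexDominates n (mu a') (mu a)}

open Classical in
/-- The arms that are lexicographic optimal in the objectives before `i`, but not lexicographic
optimal in the objectives up to and including `i`. -/
def lexSuboptimal {A D : ℕ} (mu : Fin A → Fin D → ℝ) (i : Fin D) : Finset (Fin A) :=
  Finset.univ.filter fun a => a ∈ lexOptimal mu (i : ℕ) ∧ a ∉ lexOptimal mu ((i : ℕ) + 1)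

/-- The gap of arm `a` in objective `i` with respect to the arm `star`. -/
def gap {A D : ℕ} (mu : Fin A → Fin D → ℝ) (star a : Fin A) (i : Fin D) : ℝ :=
  mu star i - mu a i

/-- The minimum gap in objective `i` among the arms in `lexSuboptimal mu i`; it is `∞` if there
is no such arm. -/
def minGap {A D : ℕ} (mu : Fin A → Fin D → ℝ) (star : Fin A) (i : Fin D) : EReal :=
  ⨅ a ∈ lexSuboptimal mu i, ((gap mu star a i : ℝ) : EReal)

/-- What the learner has observed before round `t`: the arms selected and the reward vectors
received in the rounds `0, …, t - 1`. -/
abbrev History (A D t : ℕ) : Type := Fin t → Fin A × (Fin D → ℝ)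

/-- The number of times that arm `a` was selected. -/
def pulls {A D t : ℕ} (h : History A D t) (a : Fin A) : ℕ :=
  (Finset.univ.filter fun s : Fin t => (h s).1 = a).card

/-- The sample mean of the rewards of arm `a` in objective `i`. -/
def sampleMean {A D t : ℕ} (h : History A D t) (a : Fin A) (i : Fin D) : ℝ :=
  (∑ s : Fin t, if (h s).1 = a then (h s).2 i else 0) / (pulls h a : ℝ)

open Classical in
/-- The set of estimated lexicographic optimal arms of NOM-LEX. -/
def estOptimal {A D t : ℕ} (eta : Fin D → ℝ) (h : History A D t) : Finset (Fin A) :=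
  Finset.univ.filter fun a =>
    ∀ i : Fin D, eta i - √(4 * Real.log (pulls h a) / (pulls h a)) < sampleMean h a i

open Classical in
/-- The round-robin position of NOM-LEX at the beginning of round `t`: the position `k ≠ 0` says
that a run through all arms is under way, in which arm `k` is the next one; at the position `0`
no run is under way. The first `A` rounds are such a run. A further run starts whenever, after
the first `A` rounds and with no run under way, the set of estimated optimal arms is empty. -/
def position {A D : ℕ} (eta : Fin D → ℝ) : (t : ℕ) → History A D t → ℕ
  | 0, _ => 0
  | t + 1, h =>
      if A ≤ t ∧ position eta t (Fin.init h) = 0 ∧ (estOptimal eta (Fin.init h)).Nonempty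
      then 0
      else (position eta t (Fin.init h) + 1) % A

/-- NOM-LEX exploits in round `t`: the first `A` rounds are over, no run through all arms is under
way, and the set of estimated optimal arms is not empty. -/
def Exploits {A D t : ℕ} (eta : Fin D → ℝ) (h : History A D t) : Prop :=
  A ≤ t ∧ position eta t h = 0 ∧ (estOptimal eta h).Nonempty

open Classical in
/-- The probability with which NOM-LEX selects arm `b` after the history `h`: uniform on the
estimated optimal arms if it exploits, and otherwise the arm at the round-robin position. -/
def selectProb {A D t : ℕ} (eta : Fin D → ℝ) (h : History A D t) (b : Fin A) : ℝ≥0∞ :=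
  if Exploits eta h then
    if b ∈ estOptimal eta h then ((estOptimal eta h).card : ℝ≥0∞)⁻¹ else 0
  else
    if (b : ℕ) = position eta t h then 1 else 0

/-- The random history before round `t` if `arm s` is selected in round `s` and the reward vector
`mu (arm s) + noise s` is observed. -/
def history {A D : ℕ} {Ω : Type*} (mu : Fin A → Fin D → ℝ) (arm : ℕ → Ω → Fin A)
    (noise : ℕ → Ω → Fin D → ℝ) (t : ℕ) (ω : Ω) : History A D t :=
  fun s => (arm s ω, fun i => mu (arm s ω) i + noise s ω i)

/-- The noise distributions: for every arm `a` a distribution `ν a` of the noise vector, whose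
marginals have mean zero and are 1-sub-Gaussian. The coordinates may be dependent. -/
structure IsNoiseFamily {A D : ℕ} (ν : Fin A → Measure (Fin D → ℝ)) : Prop where
  isProbabilityMeasure : ∀ a, IsProbabilityMeasure (ν a)
  mean_zero : ∀ a i, ∫ x, x i ∂(ν a) = 0
  subgaussian : ∀ a i, HasSubgaussianMGF (fun x : Fin D → ℝ => x i) 1 (ν a)

/-- The selected arms `arm t` and the noise vectors `noise t` come from a run of NOM-LEX with
inputs `eta`, on a bandit with expected rewards `mu` and noise distributions `ν`. -/
structure IsNOMLEXRun {A D : ℕ} {Ω : Type*} [MeasurableSpace Ω] (P : Measure Ω)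
    (mu : Fin A → Fin D → ℝ) (ν : Fin A → Measure (Fin D → ℝ)) (eta : Fin D → ℝ)
    (arm : ℕ → Ω → Fin A) (noise : ℕ → Ω → Fin D → ℝ) : Prop where
  measurable_arm : ∀ t, Measurable (arm t)
  measurable_noise : ∀ t, Measurable (noise t)
  /-- Given the history, the arm is drawn from the selection rule of NOM-LEX. -/
  select : ∀ (t : ℕ) (b : Fin A) (H : Set (History A D t)), MeasurableSet H →
    P {ω | history mu arm noise t ω ∈ H ∧ arm t ω = b} =
      ∫⁻ ω in {ω | history mu arm noise t ω ∈ H},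
        selectProb eta (history mu arm noise t ω) b ∂P
  /-- Given that arm `b` is selected, the noise vector has law `ν b`, independently of the past. -/
  noise_law : ∀ (t : ℕ) (b : Fin A) (H : Set (History A D t)) (B : Set (Fin D → ℝ)),
    MeasurableSet H → MeasurableSet B →
    P {ω | history mu arm noise t ω ∈ H ∧ arm t ω = b ∧ noise t ω ∈ B} =
      P {ω | history mu arm noise t ω ∈ H ∧ arm t ω = b} * ν b B

open Classical in
/-- The priority-based regret in objective `i` over the first `T` rounds. -/
def regretPB {A D : ℕ} {Ω : Type*} (mu : Fin A → Fin D → ℝ) (star : Fin A)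
    (arm : ℕ → Ω → Fin A) (i : Fin D) (T : ℕ) (ω : Ω) : ℝ :=
  ∑ t ∈ Finset.range T,
    if arm t ω ∈ lexSuboptimal mu i then gap mu star (arm t ω) i else 0

end LexBandit

end

open LexBandit

/-! Fix a suboptimal arm `a` and split its selections into those made in runs through all arms and
those made while exploiting. Apart from the initial run, a run starts only if no arm passes the
test, so the optimal arm `star` fails it; as each run selects `star` once, different run starts see
different sample sizes `m` of `star`. Likewise, exploiting selections of `a` happen at different
sample sizes at which `a` passes. Hence the number of selections of `a` is at most 1 plus the number
of `m` at which `star` fails, plus the number of `m` at which `a` passes (`armCount_le_of_follows`).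
The events are indexed by sample size and not by round, so no union over rounds is needed, and the
bound does not grow with `T`.

The noise sum over the first `m` selections of an arm is sub-Gaussian with variance proxy `m`, by a
supermartingale argument (`lintegral_expProcess_le`). Thus `star` fails at size `m` with probability
at most `D / m ^ 2`, which sums to `D * π ^ 2 / 6`. For `a`, take the objective `j` maximizing `c =
gap j - delta j = eta j - mu a j`, positive by the lower bound on `eta`. Once the confidence radius
is at most `c / 2`, passing has probability at most `exp (-m c ^ 2 / 8)`; the smaller `m` are
counted in full (`sum_exploit_prob_le`).

For large `c` the term `log (17 / c)` may be negative, so the second sum is bounded only up to an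
extra `25 / 1000`. This is regained from a sharper failure bound at `m = 2` and `m = 3`
(`prob_cappedNoise_mul_le`, `le_failureBound`). -/

namespace LexBandit

/-! ### Pathwise counting of selections by sample size. -/

section Deterministic

variable {A D : ℕ}

/-- The history before round `t` of a sequence of selected arms and observed rewards. -/
def prefixHistory (x : ℕ → Fin A × (Fin D → ℝ)) (t : ℕ) : History A D t := fun s => x s

/-- The number of rounds before round `t` in which arm `b` is selected. -/
def armCount (arm : ℕ → Fin A) (b : Fin A) (t : ℕ) : ℕ := Nat.count (fun s => arm s = b) t

lemma armCount_mono (arm : ℕ → Fin A) (b : Fin A) : Monotone (armCount arm b) :=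
  Nat.count_monotone _

lemma armCount_le (arm : ℕ → Fin A) (b : Fin A) (t : ℕ) : armCount arm b t ≤ t :=
  Nat.count_le _

lemma pulls_prefixHistory (x : ℕ → Fin A × (Fin D → ℝ)) (b : Fin A) (t : ℕ) :
    pulls (prefixHistory x t) b = armCount (fun s => (x s).1) b t := by
  unfold pulls armCount prefixHistory
  rw [Nat.count_eq_card_filter_range, Finset.card_filter, Finset.card_filter]
  exact Fin.sum_univ_eq_sum_range (fun s => if (x s).1 = b then 1 else 0) t

/-- The sequence respects the selection rule of NOM-LEX in every round. -/
def Follows (eta : Fin D → ℝ) (x : ℕ → Fin A × (Fin D → ℝ)) : Prop :=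
  ∀ t, (Exploits eta (prefixHistory x t) → (x t).1 ∈ estOptimal eta (prefixHistory x t)) ∧
    (¬ Exploits eta (prefixHistory x t) → ((x t).1 : ℕ) = position eta t (prefixHistory x t))

lemma position_prefixHistory_succ (eta : Fin D → ℝ) (x : ℕ → Fin A × (Fin D → ℝ)) (t : ℕ)
    [Decidable (Exploits eta (prefixHistory x t))] :
    position eta (t + 1) (prefixHistory x (t + 1)) =
      if Exploits eta (prefixHistory x t) then 0
      else (position eta t (prefixHistory x t) + 1) % A := by
  rw [position]
  have : Fin.init (prefixHistory x (t + 1)) = prefixHistory x t := rfl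
  simp only [this, Exploits]
  congr

lemma position_eq_of_lt (eta : Fin D → ℝ) (x : ℕ → Fin A × (Fin D → ℝ)) {t : ℕ} (ht : t < A) :
    position eta t (prefixHistory x t) = t := by
  classical
  induction t with
  | zero => rfl
  | succ t ih =>
    rw [position_prefixHistory_succ, if_neg (fun h => by have := h.1; omega), ih (by omega),
      Nat.mod_eq_of_lt ht]

open Classical in
/-- The number of runs through all arms that start before round `t`. -/
noncomputable def runCount (eta : Fin D → ℝ) (x : ℕ → Fin A × (Fin D → ℝ)) (t : ℕ) : ℕ :=
  Nat.count (fun s => position eta s (prefixHistory x s) = 0 ∧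
    ¬ Exploits eta (prefixHistory x s)) t

open Classical in
/-- The number of selections of arm `b` before round `t` that belong to runs through all arms. -/
noncomputable def runPulls (eta : Fin D → ℝ) (x : ℕ → Fin A × (Fin D → ℝ)) (b : Fin A) (t : ℕ) : ℕ :=
  Nat.count (fun s => (x s).1 = b ∧ ¬ Exploits eta (prefixHistory x s)) t

open Classical in
/-- The number of selections of arm `b` before round `t` in which NOM-LEX exploits. -/
noncomputable def exploitPulls (eta : Fin D → ℝ) (x : ℕ → Fin A × (Fin D → ℝ)) (b : Fin A) (t : ℕ) : ℕ :=
  Nat.count (fun s => (x s).1 = b ∧ Exploits eta (prefixHistory x s)) t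

lemma armCount_eq_runPulls_add_exploitPulls (eta : Fin D → ℝ) (x : ℕ → Fin A × (Fin D → ℝ))
    (b : Fin A) (t : ℕ) :
    armCount (fun s => (x s).1) b t = runPulls eta x b t + exploitPulls eta x b t := by
  induction t with
  | zero => simp [armCount, runPulls, exploitPulls]
  | succ t ih =>
    simp only [armCount, runPulls, exploitPulls, Nat.count_succ] at ih ⊢
    rw [ih]
    by_cases h1 : (x t).1 = b <;> by_cases h2 : Exploits eta (prefixHistory x t) <;>
      simp [h1, h2] <;> omega

/-- Every completed run selects `b` exactly once. The correction is 1 exactly when a run is under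
way that has not yet reached `b`. -/
lemma runPulls_add_eq_runCount {eta : Fin D → ℝ} {x : ℕ → Fin A × (Fin D → ℝ)}
    (hx : Follows eta x) (b : Fin A) (t : ℕ) :
    runPulls eta x b t +
      (if 0 < position eta t (prefixHistory x t) ∧ position eta t (prefixHistory x t) ≤ b
        then 1 else 0) = runCount eta x t := by
  classical
  induction t with
  | zero => simp [runPulls, runCount, position]
  | succ t ih =>
    rw [position_prefixHistory_succ]
    simp only [runPulls, runCount, Nat.count_succ] at ih ⊢
    rw [← ih]
    obtain ⟨-, h2⟩ := hx t
    by_cases h : Exploits eta (prefixHistory x t)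
    · have : position eta t (prefixHistory x t) = 0 := h.2.1
      simp [h, this]
    · have hk := h2 h
      have hb := b.isLt
      have ha := (x t).1.isLt
      have hab : (x t).1 = b ↔ ((x t).1 : ℕ) = b := Fin.ext_iff
      simp only [h, not_false_eq_true, and_true, if_false, hab, ← hk]
      generalize ((x t).1 : ℕ) = k at *
      rcases Nat.lt_or_ge (k + 1) A with h3 | h3
      · rw [Nat.mod_eq_of_lt h3]
        split_ifs <;> omega
      · have : k + 1 = A := by omega
        rw [this, Nat.mod_self]
        split_ifs <;> omega

lemma runPulls_eq_runCount {eta : Fin D → ℝ} {x : ℕ → Fin A × (Fin D → ℝ)}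
    (hx : Follows eta x) (b : Fin A) {t : ℕ} (ht : position eta t (prefixHistory x t) = 0) :
    runPulls eta x b t = runCount eta x t := by
  simpa [ht] using runPulls_add_eq_runCount hx b t

lemma runPulls_le_runCount {eta : Fin D → ℝ} {x : ℕ → Fin A × (Fin D → ℝ)}
    (hx : Follows eta x) (b : Fin A) (t : ℕ) : runPulls eta x b t ≤ runCount eta x t := by
  rw [← runPulls_add_eq_runCount hx b t]
  exact Nat.le_add_right _ _

lemma not_exploits_zero (hA : 0 < A) (eta : Fin D → ℝ) (x : ℕ → Fin A × (Fin D → ℝ)) :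
    ¬ Exploits eta (prefixHistory x 0) := fun h => by have := h.1; omega

lemma one_le_runCount (hA : 0 < A) (eta : Fin D → ℝ) (x : ℕ → Fin A × (Fin D → ℝ)) {t : ℕ}
    (ht : 0 < t) : 1 ≤ runCount eta x t := by
  classical
  calc 1 = runCount eta x 1 := by
        simp [runCount, Nat.count_succ, not_exploits_zero hA, position]
    _ ≤ runCount eta x t := Nat.count_monotone _ ht

lemma one_le_armCount {eta : Fin D → ℝ} {x : ℕ → Fin A × (Fin D → ℝ)}
    (hx : Follows eta x) (b : Fin A) {t : ℕ} (h0 : 0 < t)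
    (ht : position eta t (prefixHistory x t) = 0) : 1 ≤ armCount (fun s => (x s).1) b t := by
  have h1 := one_le_runCount b.pos eta x h0
  have h2 := runPulls_eq_runCount hx b ht
  have h3 := armCount_eq_runPulls_add_exploitPulls eta x b t
  omega

-- Run starts are mapped to the sample size of `b` at that time. The map is injective on run starts,
-- because the run begun at the earlier one selects `b` before the later one.
open Classical in
lemma runCount_le {eta : Fin D → ℝ} {x : ℕ → Fin A × (Fin D → ℝ)}
    (hx : Follows eta x) (b : Fin A) (T : ℕ) :
    runCount eta x T ≤ 1 + ((Finset.Icc 1 T).filter fun m => ∃ t < T,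
      armCount (fun s => (x s).1) b t = m ∧ b ∉ estOptimal eta (prefixHistory x t)).card := by
  classical
  unfold runCount
  rw [Nat.count_eq_card_filter_range]
  set R := (Finset.range T).filter fun s => position eta s (prefixHistory x s) = 0 ∧
    ¬ Exploits eta (prefixHistory x s) with hR
  -- The run starting in round 0 is not caused by a failed test and accounts for the summand 1.
  have h1 : R.card ≤ 1 + (R.erase 0).card := by
    have := Finset.pred_card_le_card_erase (s := R) (a := 0)
    omega
  refine h1.trans (Nat.add_le_add_left ?_ 1)
  have hstrict : ∀ s ∈ R, ∀ s' ∈ R, s < s' →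
      armCount (fun s => (x s).1) b s < armCount (fun s => (x s).1) b s' := by
    intro s hs s' hs' hlt
    simp only [hR, Finset.mem_filter] at hs hs'
    have e1 := armCount_eq_runPulls_add_exploitPulls eta x b s
    have e2 := armCount_eq_runPulls_add_exploitPulls eta x b s'
    have e3 := runPulls_eq_runCount hx b hs.2.1
    have e4 := runPulls_eq_runCount hx b hs'.2.1
    have e5 : exploitPulls eta x b s ≤ exploitPulls eta x b s' := Nat.count_monotone _ hlt.le
    have e6 : runCount eta x s < runCount eta x s' := Nat.count_strict_mono hs.2 hlt
    omega
  refine Finset.card_le_card_of_injOn (fun s => armCount (fun s => (x s).1) b s) ?_ ?_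
  · intro s hs
    have hs' := Finset.mem_erase.1 (Finset.mem_coe.1 hs)
    simp only [hR, Finset.mem_filter, Finset.mem_range] at hs'
    obtain ⟨h0, hT, hp, he⟩ := hs'
    -- During the initial run the position equals the round, so position 0 occurs there only in
    -- round 0.
    have hAs : A ≤ s := by
      by_contra hlt
      rw [position_eq_of_lt eta x (by omega)] at hp
      exact h0 hp
    simp only [Finset.coe_filter, Finset.mem_Icc, Set.mem_ofPred_eq]
    refine ⟨⟨one_le_armCount hx b (by omega) hp, (armCount_le _ _ _).trans hT.le⟩, s, hT, rfl, ?_⟩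
    exact fun hb => he ⟨hAs, hp, ⟨b, hb⟩⟩
  · intro s hs s' hs' heq
    have m1 := Finset.mem_of_mem_erase (Finset.mem_coe.1 hs)
    have m2 := Finset.mem_of_mem_erase (Finset.mem_coe.1 hs')
    rcases lt_trichotomy s s' with h | h | h
    · exact absurd heq (hstrict s m1 s' m2 h).ne
    · exact h
    · exact absurd heq (hstrict s' m2 s m1 h).ne'

open Classical in
lemma exploitPulls_le {eta : Fin D → ℝ} {x : ℕ → Fin A × (Fin D → ℝ)}
    (hx : Follows eta x) (b : Fin A) (T : ℕ) :
    exploitPulls eta x b T ≤ ((Finset.Icc 1 T).filter fun m => ∃ t < T,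
      armCount (fun s => (x s).1) b t = m ∧ b ∈ estOptimal eta (prefixHistory x t)).card := by
  classical
  unfold exploitPulls
  rw [Nat.count_eq_card_filter_range]
  refine Finset.card_le_card_of_injOn (fun s => armCount (fun s => (x s).1) b s) ?_ ?_
  · intro s hs
    simp only [Finset.coe_filter, Finset.mem_range, Set.mem_ofPred_eq] at hs
    obtain ⟨hT, hb, he⟩ := hs
    simp only [Finset.coe_filter, Finset.mem_Icc, Set.mem_ofPred_eq]
    exact ⟨⟨one_le_armCount hx b (b.pos.trans_le he.1) he.2.1, (armCount_le _ _ _).trans hT.le⟩,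
      s, hT, rfl, hb ▸ (hx s).1 he⟩
  · intro s hs s' hs' heq
    simp only [Finset.coe_filter, Set.mem_ofPred_eq] at hs hs'
    exact Nat.count_injective hs.2.1 hs'.2.1 heq

open Classical in
lemma armCount_le_of_follows {eta : Fin D → ℝ} {x : ℕ → Fin A × (Fin D → ℝ)}
    (hx : Follows eta x) (a b : Fin A) (T : ℕ) :
    armCount (fun s => (x s).1) a T ≤ 1 +
      ((Finset.Icc 1 T).filter fun m => ∃ t < T,
        armCount (fun s => (x s).1) b t = m ∧ b ∉ estOptimal eta (prefixHistory x t)).card +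
      ((Finset.Icc 1 T).filter fun m => ∃ t < T,
        armCount (fun s => (x s).1) a t = m ∧ a ∈ estOptimal eta (prefixHistory x t)).card := by
  rw [armCount_eq_runPulls_add_exploitPulls eta x a T]
  exact Nat.add_le_add ((runPulls_le_runCount hx a T).trans (runCount_le hx b T))
    (exploitPulls_le hx a T)

/-- The sum of the values `z s` over the first `m` selections of arm `b`, as far as they happen
before round `t`. -/
def cappedSum (arm : ℕ → Fin A) (z : ℕ → ℝ) (b : Fin A) (m t : ℕ) : ℝ :=
  ∑ s ∈ Finset.range t, if arm s = b ∧ armCount arm b s < m then z s else 0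

/-- The left side does not involve `t`: whatever the round in which the sample size is `m`, the same
random variable at horizon `T` describes the sample. -/
lemma cappedSum_eq_sum (arm : ℕ → Fin A) (z : ℕ → ℝ) (b : Fin A) {m t T : ℕ} (htT : t ≤ T)
    (hm : armCount arm b t = m) :
    cappedSum arm z b m T = ∑ s ∈ Finset.range t, if arm s = b then z s else 0 := by
  unfold cappedSum
  rw [← Finset.sum_subset (Finset.range_mono htT)]
  · refine Finset.sum_congr rfl fun s hs => ?_
    by_cases h : arm s = b
    · have h2 : armCount arm b s < armCount arm b t :=
        Nat.count_strict_mono h (Finset.mem_range.1 hs)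
      simp [h, ← hm, h2]
    · simp [h]
  · intro s _ hs
    have h2 : armCount arm b t ≤ armCount arm b s :=
      armCount_mono arm b (not_lt.1 fun h => hs (Finset.mem_range.2 h))
    rw [if_neg]
    rintro ⟨-, h⟩
    omega

lemma sampleMean_prefixHistory (arm : ℕ → Fin A) (mu : Fin A → Fin D → ℝ) (z : ℕ → Fin D → ℝ)
    (b : Fin A) (i : Fin D) {m t T : ℕ} (htT : t ≤ T) (hm : armCount arm b t = m) (hm1 : 1 ≤ m) :
    sampleMean (prefixHistory (fun s => (arm s, fun i => mu (arm s) i + z s i)) t) b i =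
      mu b i + cappedSum arm (fun s => z s i) b m T / m := by
  have hm0 : (m : ℝ) ≠ 0 := by positivity
  unfold sampleMean
  rw [pulls_prefixHistory, hm, cappedSum_eq_sum arm _ b htT hm]
  have : (∑ s : Fin t, if arm s = b then mu (arm s) i + z s i else 0) =
      m * mu b i + ∑ s ∈ Finset.range t, if arm s = b then z s i else 0 := by
    rw [Fin.sum_univ_eq_sum_range (fun s => if arm s = b then mu (arm s) i + z s i else 0) t,
      ← hm, armCount, Nat.count_eq_card_filter_range, Finset.card_filter, Nat.cast_sum,
      Finset.sum_mul, ← Finset.sum_add_distrib]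
    refine Finset.sum_congr rfl fun s _ => ?_
    split_ifs with h <;> simp [h]
  change (∑ s : Fin t, if arm s = b then mu (arm s) i + z s i else 0) / (m : ℝ) = _
  rw [this]
  field_simp

end Deterministic

/-! ### Measurability of the quantities of the algorithm. -/

section Measurability

variable {A D : ℕ} {Ω : Type*} [MeasurableSpace Ω]

omit [MeasurableSpace Ω] in
lemma history_eq_prefixHistory (mu : Fin A → Fin D → ℝ) (arm : ℕ → Ω → Fin A)
    (noise : ℕ → Ω → Fin D → ℝ) (t : ℕ) (ω : Ω) :
    history mu arm noise t ω =
      prefixHistory (fun s => (arm s ω, fun i => mu (arm s ω) i + noise s ω i)) t := rfl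

lemma measurable_history {arm : ℕ → Ω → Fin A} {noise : ℕ → Ω → Fin D → ℝ}
    (harm : ∀ t, Measurable (arm t)) (hnoise : ∀ t, Measurable (noise t))
    (mu : Fin A → Fin D → ℝ) (t : ℕ) : Measurable (history mu arm noise t) := by
  refine measurable_pi_lambda _ fun s => (harm s).prodMk (measurable_pi_lambda _ fun i => ?_)
  exact ((measurable_of_countable fun a => mu a i).comp (harm s)).add
    ((measurable_pi_apply i).comp (hnoise s))

lemma measurable_pulls (t : ℕ) (b : Fin A) :
    Measurable fun h : History A D t => pulls h b := by
  simp only [pulls, Finset.card_filter]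
  refine Finset.measurable_sum _ fun s _ => Measurable.ite ?_ measurable_const measurable_const
  exact (measurable_fst.comp (measurable_pi_apply s)) (measurableSet_singleton b)

lemma measurable_sampleMean (t : ℕ) (b : Fin A) (i : Fin D) :
    Measurable fun h : History A D t => sampleMean h b i := by
  refine Measurable.div (Finset.measurable_sum _ fun s _ => Measurable.ite ?_ ?_ measurable_const)
    (measurable_from_nat.comp (measurable_pulls t b))
  · exact (measurable_fst.comp (measurable_pi_apply s)) (measurableSet_singleton b)
  · exact (measurable_pi_apply i).comp (measurable_snd.comp (measurable_pi_apply s))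

lemma measurableSet_mem_estOptimal (eta : Fin D → ℝ) (t : ℕ) (b : Fin A) :
    MeasurableSet {h : History A D t | b ∈ estOptimal eta h} := by
  have : {h : History A D t | b ∈ estOptimal eta h} = ⋂ i : Fin D,
      {h | eta i - √(4 * Real.log (pulls h b) / (pulls h b)) < sampleMean h b i} := by
    ext h
    simp [estOptimal]
  rw [this]
  refine MeasurableSet.iInter fun i => measurableSet_lt ?_ (measurable_sampleMean t b i)
  exact (measurable_from_nat (f := fun n : ℕ => eta i - √(4 * Real.log n / n))).comp
    (measurable_pulls t b)

lemma measurableSet_estOptimal_nonempty (eta : Fin D → ℝ) (t : ℕ) :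
    MeasurableSet {h : History A D t | (estOptimal eta h).Nonempty} := by
  have : {h : History A D t | (estOptimal eta h).Nonempty} =
      ⋃ b : Fin A, {h | b ∈ estOptimal eta h} := by
    ext h
    simp [Finset.Nonempty]
  rw [this]
  exact MeasurableSet.iUnion fun b => measurableSet_mem_estOptimal eta t b

lemma measurable_position (eta : Fin D → ℝ) (t : ℕ) :
    Measurable (position (A := A) eta t) := by
  induction t with
  | zero => exact measurable_const
  | succ t ih =>
    have hinit : Measurable fun h : History A D (t + 1) => (Fin.init h : History A D t) :=
      measurable_pi_lambda _ fun s => measurable_pi_apply _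
    refine Measurable.ite ?_ measurable_const
      ((measurable_from_nat (f := fun n : ℕ => (n + 1) % A)).comp (ih.comp hinit))
    refine MeasurableSet.inter (MeasurableSet.const _) (MeasurableSet.inter ?_ ?_)
    · exact (ih.comp hinit) (measurableSet_singleton 0)
    · exact hinit (measurableSet_estOptimal_nonempty eta t)

lemma measurableSet_exploits (eta : Fin D → ℝ) (t : ℕ) :
    MeasurableSet {h : History A D t | Exploits eta h} :=
  MeasurableSet.inter (MeasurableSet.const _) (MeasurableSet.inter
    (measurable_position eta t (measurableSet_singleton 0))
    (measurableSet_estOptimal_nonempty eta t))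

lemma measurable_armCount {arm : ℕ → Ω → Fin A} (b : Fin A) (t : ℕ)
    (harm : ∀ s < t, Measurable (arm s)) :
    Measurable fun ω => armCount (fun s => arm s ω) b t := by
  simp only [armCount, Nat.count_eq_card_filter_range, Finset.card_filter]
  refine Finset.measurable_sum _ fun s hs => Measurable.ite ?_ measurable_const measurable_const
  exact harm s (Finset.mem_range.1 hs) (measurableSet_singleton b)

lemma measurable_cappedSum {arm : ℕ → Ω → Fin A} {z : ℕ → Ω → ℝ} (b : Fin A) (m t : ℕ)
    (harm : ∀ s < t, Measurable (arm s)) (hz : ∀ s < t, Measurable (z s)) :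
    Measurable fun ω => cappedSum (fun s => arm s ω) (fun s => z s ω) b m t := by
  refine Finset.measurable_sum _ fun s hs => ?_
  have hs := Finset.mem_range.1 hs
  refine Measurable.ite (MeasurableSet.inter (harm s hs (measurableSet_singleton b)) ?_) (hz s hs)
    measurable_const
  exact measurable_armCount b s (fun r hr => harm r (hr.trans hs)) (measurableSet_Iio (a := m))

/-- The sequence that agrees with `h` before round `t` and is constant afterwards. -/
def extendHistory {t : ℕ} (b : Fin A) (h : History A D t) (s : ℕ) : Fin A × (Fin D → ℝ) :=
  if hs : s < t then h ⟨s, hs⟩ else (b, 0)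

lemma measurable_extendHistory {t : ℕ} (b : Fin A) (s : ℕ) :
    Measurable fun h : History A D t => extendHistory b h s := by
  unfold extendHistory
  split_ifs with hs
  · exact measurable_pi_apply _
  · exact measurable_const

end Measurability

lemma armCount_congr {A : ℕ} {arm arm' : ℕ → Fin A} {b : Fin A} {t : ℕ}
    (h : ∀ s < t, arm s = arm' s) : armCount arm b t = armCount arm' b t := by
  simp only [armCount, Nat.count_eq_card_filter_range]
  congr 1
  exact Finset.filter_congr fun s hs => by rw [h s (Finset.mem_range.1 hs)]

lemma cappedSum_congr {A : ℕ} {arm arm' : ℕ → Fin A} {z z' : ℕ → ℝ} {b : Fin A} {m t : ℕ}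
    (h : ∀ s < t, arm s = arm' s) (hz : ∀ s < t, arm s = b → z s = z' s) :
    cappedSum arm z b m t = cappedSum arm' z' b m t := by
  refine Finset.sum_congr rfl fun s hs => ?_
  have hs := Finset.mem_range.1 hs
  rw [armCount_congr fun r hr => h r (hr.trans hs), ← h s hs]
  by_cases hb : arm s = b
  · rw [hz s hs hb]
  · simp [hb]

/-! ### The law of a run and concentration of the noise sums. -/

section Run

variable {A D : ℕ} {Ω : Type*} [MeasurableSpace Ω] {P : Measure Ω} [IsProbabilityMeasure P]
  {mu : Fin A → Fin D → ℝ} {ν : Fin A → Measure (Fin D → ℝ)} {eta : Fin D → ℝ}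
  {arm : ℕ → Ω → Fin A} {noise : ℕ → Ω → Fin D → ℝ}

-- For each round and arm, the event that the arm is selected although its selection probability is
-- 0 is null; there are countably many such events.
omit [IsProbabilityMeasure P] in
lemma IsNOMLEXRun.ae_follows (hrun : IsNOMLEXRun P mu ν eta arm noise) :
    ∀ᵐ ω ∂P, Follows eta fun s => (arm s ω, fun i => mu (arm s ω) i + noise s ω i) := by
  have hsel : ∀ t (b : Fin A), ∀ᵐ ω ∂P, ¬ (history mu arm noise t ω ∈
      {h : History A D t | selectProb eta h b = 0} ∧ arm t ω = b) := by
    intro t b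
    have hset : {h : History A D t | selectProb eta h b = 0} =
        ({h | Exploits eta h} ∩ {h | b ∈ estOptimal eta h}ᶜ) ∪
        ({h | Exploits eta h}ᶜ ∩ {h | (b : ℕ) = position eta t h}ᶜ) := by
      ext h
      simp only [selectProb, Set.mem_union, Set.mem_inter_iff, Set.mem_compl_iff,
        Set.mem_ofPred_eq]
      split_ifs with h1 h2 h2 <;> simp [h1, h2]
    have hmeas : MeasurableSet {h : History A D t | selectProb eta h b = 0} := by
      rw [hset]
      refine ((measurableSet_exploits eta t).inter (measurableSet_mem_estOptimal eta t b).compl).union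
        ((measurableSet_exploits eta t).compl.inter (MeasurableSet.compl ?_))
      simp only [eq_comm (a := (b : ℕ))]
      exact measurable_position eta t (measurableSet_singleton (b : ℕ))
    have h0 := hrun.select t b _ hmeas
    have hzero : ∫⁻ ω in {ω | history mu arm noise t ω ∈ {h | selectProb eta h b = 0}},
        selectProb eta (history mu arm noise t ω) b ∂P = 0 :=
      setLIntegral_eq_zero
        (measurable_history hrun.measurable_arm hrun.measurable_noise mu t hmeas) fun ω hω => hω
    rw [hzero] at h0
    rw [ae_iff]
    simpa using h0
  filter_upwards [ae_all_iff.2 fun t => ae_all_iff.2 (hsel t)] with ω hω t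
  have h1 : selectProb eta (history mu arm noise t ω) (arm t ω) ≠ 0 := fun h =>
    hω t (arm t ω) ⟨h, rfl⟩
  rw [history_eq_prefixHistory] at h1
  unfold selectProb at h1
  constructor
  · intro he
    by_contra hn
    exact h1 (by rw [if_pos he, if_neg hn])
  · intro he
    by_contra hn
    exact h1 (by rw [if_neg he, if_neg hn])

omit [IsProbabilityMeasure P] in
lemma IsNOMLEXRun.map_noise (hrun : IsNOMLEXRun P mu ν eta arm noise) (t : ℕ) (b : Fin A)
    {H : Set (History A D t)} (hH : MeasurableSet H) :
    (P.restrict {ω | history mu arm noise t ω ∈ H ∧ arm t ω = b}).map (noise t) =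
      P {ω | history mu arm noise t ω ∈ H ∧ arm t ω = b} • ν b := by
  ext B hB
  rw [Measure.map_apply (hrun.measurable_noise t) hB,
    Measure.restrict_apply (hrun.measurable_noise t hB), Measure.smul_apply, smul_eq_mul,
    ← hrun.noise_law t b H B hH hB]
  congr 1
  ext ω
  simp only [Set.mem_inter_iff, Set.mem_preimage, Set.mem_ofPred_eq]
  tauto

/-- On the event, the joint law of history and noise is a product measure, since `noise_law`
determines it on rectangles. -/
lemma IsNOMLEXRun.setLIntegral_mul_noise (hrun : IsNOMLEXRun P mu ν eta arm noise)
    (hν : IsNoiseFamily ν) (t : ℕ) (b : Fin A)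
    {H : Set (History A D t)} (hH : MeasurableSet H)
    {f : History A D t → ℝ≥0∞} (hf : Measurable f) {g : (Fin D → ℝ) → ℝ≥0∞} (hg : Measurable g) :
    ∫⁻ ω in {ω | history mu arm noise t ω ∈ H ∧ arm t ω = b},
        f (history mu arm noise t ω) * g (noise t ω) ∂P =
      (∫⁻ ω in {ω | history mu arm noise t ω ∈ H ∧ arm t ω = b},
        f (history mu arm noise t ω) ∂P) * ∫⁻ x, g x ∂ν b := by
  have := hν.isProbabilityMeasure b
  have hh := measurable_history hrun.measurable_arm hrun.measurable_noise mu t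
  have hn := hrun.measurable_noise t
  set E := {ω | history mu arm noise t ω ∈ H ∧ arm t ω = b} with hE
  have hmap : (P.restrict E).map (fun ω => (history mu arm noise t ω, noise t ω)) =
      ((P.restrict E).map (history mu arm noise t)).prod (ν b) := by
    symm
    refine Measure.prod_eq fun S B hS hB => ?_
    rw [Measure.map_apply (hh.prodMk hn) (hS.prod hB), Measure.map_apply hh hS,
      Measure.restrict_apply ((hh.prodMk hn) (hS.prod hB)), Measure.restrict_apply (hh hS)]
    have := hrun.noise_law t b (S ∩ H) B (hS.inter hH) hB
    convert this using 2
    · ext ω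
      simp only [hE, Set.mem_inter_iff, Set.mem_preimage, Set.mem_prod, Set.mem_ofPred_eq]
      tauto
    · congr 1
      ext ω
      simp only [hE, Set.mem_inter_iff, Set.mem_preimage, Set.mem_ofPred_eq]
      tauto
  have h1 : ∫⁻ ω in E, f (history mu arm noise t ω) * g (noise t ω) ∂P =
      ∫⁻ p, f p.1 * g p.2 ∂(P.restrict E).map (fun ω => (history mu arm noise t ω, noise t ω)) :=
    (lintegral_map ((hf.comp measurable_fst).mul (hg.comp measurable_snd)) (hh.prodMk hn)).symm
  rw [h1, hmap, lintegral_prod_mul hf.aemeasurable hg.aemeasurable, lintegral_map hf hh]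

lemma IsNoiseFamily.lintegral_exp_le (hν : IsNoiseFamily ν) (b : Fin A) (i : Fin D) (c : ℝ) :
    ∫⁻ x, ENNReal.ofReal (Real.exp (c * x i - c ^ 2 / 2)) ∂ν b ≤ 1 := by
  have h := hν.subgaussian b i
  have hint : Integrable (fun x : Fin D → ℝ => Real.exp (c * x i - c ^ 2 / 2)) (ν b) := by
    simp only [Real.exp_sub]
    exact (h.integrable_exp_mul c).div_const _
  rw [← ofReal_integral_eq_lintegral_ofReal hint (ae_of_all _ fun x => (Real.exp_pos _).le)]
  rw [← ENNReal.ofReal_one]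
  refine ENNReal.ofReal_le_ofReal ?_
  simp only [Real.exp_sub, integral_div]
  rw [div_le_one (Real.exp_pos _)]
  have := h.mgf_le c
  simpa [mgf] using this

/-- The event that arm `b` is selected in round `t` and was selected fewer than `m` times
before. -/
def cappedEvent (arm : ℕ → Ω → Fin A) (b : Fin A) (m t : ℕ) : Set Ω :=
  {ω | arm t ω = b ∧ armCount (fun s => arm s ω) b t < m}

omit [MeasurableSpace Ω] in
lemma cappedEvent_eq (mu : Fin A → Fin D → ℝ) (arm : ℕ → Ω → Fin A)
    (noise : ℕ → Ω → Fin D → ℝ) (b : Fin A) (m t : ℕ) : cappedEvent arm b m t =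
      {ω | history mu arm noise t ω ∈ {h | pulls h b < m} ∧ arm t ω = b} := by
  ext ω
  simp only [cappedEvent, Set.mem_ofPred_eq, history_eq_prefixHistory, pulls_prefixHistory]
  exact and_comm

lemma measurableSet_cappedEvent (harm : ∀ t, Measurable (arm t)) (b : Fin A) (m t : ℕ) :
    MeasurableSet (cappedEvent arm b m t) :=
  MeasurableSet.inter (harm t (measurableSet_singleton b))
    (measurable_armCount b t (fun s _ => harm s) (measurableSet_Iio (a := m)))

lemma measurableSet_pulls_lt (b : Fin A) (m t : ℕ) :
    MeasurableSet {h : History A D t | pulls h b < m} :=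
  measurable_pulls t b (measurableSet_Iio (a := m))

/-- The sum of the noise in objective `i` over the first `m` selections of arm `b`. -/
def cappedNoise (arm : ℕ → Ω → Fin A) (noise : ℕ → Ω → Fin D → ℝ) (b : Fin A) (i : Fin D)
    (m t : ℕ) (ω : Ω) : ℝ :=
  cappedSum (fun s => arm s ω) (fun s => noise s ω i) b m t

omit [IsProbabilityMeasure P] in
lemma IsNOMLEXRun.measurable_cappedNoise (hrun : IsNOMLEXRun P mu ν eta arm noise)
    (b : Fin A) (i : Fin D) (m t : ℕ) : Measurable (cappedNoise arm noise b i m t) :=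
  measurable_cappedSum b m t (fun s _ => hrun.measurable_arm s)
    fun s _ => (measurable_pi_apply i).comp (hrun.measurable_noise s)

lemma IsNOMLEXRun.integral_cappedNoise (hrun : IsNOMLEXRun P mu ν eta arm noise)
    (hν : IsNoiseFamily ν) (b : Fin A) (i : Fin D) (m t : ℕ) :
    Integrable (cappedNoise arm noise b i m t) P ∧
      ∫ ω, cappedNoise arm noise b i m t ω ∂P = 0 := by
  have hint : Integrable (fun x : Fin D → ℝ => x i) (ν b) := (hν.subgaussian b i).integrable
  have hterm : ∀ s, Integrable ((cappedEvent arm b m s).indicator fun ω => noise s ω i) P ∧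
      ∫ ω, (cappedEvent arm b m s).indicator (fun ω => noise s ω i) ω ∂P = 0 := by
    intro s
    have hE := measurableSet_cappedEvent hrun.measurable_arm b m s
    have hmap := hrun.map_noise s b (measurableSet_pulls_lt b m s)
    rw [← cappedEvent_eq] at hmap
    have hmapint : Integrable (fun x : Fin D → ℝ => x i)
        ((P.restrict (cappedEvent arm b m s)).map (noise s)) := by
      rw [hmap]
      exact hint.smul_measure (measure_ne_top _ _)
    constructor
    · rw [integrable_indicator_iff hE]
      exact (integrable_map_measure hmapint.1 (hrun.measurable_noise s).aemeasurable).1 hmapint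
    · rw [integral_indicator hE, ← integral_map (f := fun x : Fin D → ℝ => x i)
        (hrun.measurable_noise s).aemeasurable hmapint.1, hmap, integral_smul_measure,
        hν.mean_zero, smul_zero]
  have heq : cappedNoise arm noise b i m t = fun ω =>
      ∑ s ∈ Finset.range t, (cappedEvent arm b m s).indicator (fun ω => noise s ω i) ω := by
    funext ω
    simp only [cappedNoise, cappedSum]
    refine Finset.sum_congr rfl fun s _ => ?_
    simp only [Set.indicator, cappedEvent, Set.mem_ofPred_eq]
    congr
  simp only [heq]
  refine ⟨integrable_finsetSum _ fun s _ => (hterm s).1, ?_⟩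
  rw [integral_finsetSum _ fun s _ => (hterm s).1]
  exact Finset.sum_eq_zero fun s _ => (hterm s).2

/-- The compensated exponential of the capped noise, a supermartingale in `t`. -/
noncomputable def expProcess (arm : ℕ → Ω → Fin A) (noise : ℕ → Ω → Fin D → ℝ) (b : Fin A)
    (i : Fin D) (m : ℕ) (c : ℝ) (t : ℕ) (ω : Ω) : ℝ≥0∞ :=
  ENNReal.ofReal (Real.exp (c * cappedNoise arm noise b i m t ω -
    c ^ 2 / 2 * (min (armCount (fun s => arm s ω) b t) m : ℕ)))

-- This is adaptedness, needed to factor out the noise of round `t`. Past noise is recovered by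
-- subtracting `mu b i` from the rewards, which is correct in the rounds that select `b`, the only
-- ones that enter the sum.
omit [MeasurableSpace Ω] in
lemma exists_expProcess_eq_comp (mu : Fin A → Fin D → ℝ) (arm : ℕ → Ω → Fin A)
    (noise : ℕ → Ω → Fin D → ℝ) (b : Fin A) (i : Fin D) (m : ℕ) (c : ℝ) (t : ℕ) :
    ∃ f : History A D t → ℝ≥0∞, Measurable f ∧
      ∀ ω, expProcess arm noise b i m c t ω = f (history mu arm noise t ω) := by
  refine ⟨fun h => ENNReal.ofReal (Real.exp
    (c * cappedSum (fun s => (extendHistory b h s).1)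
      (fun s => (extendHistory b h s).2 i - mu b i) b m t -
    c ^ 2 / 2 * (min (armCount (fun s => (extendHistory b h s).1) b t) m : ℕ))), ?_, fun ω => ?_⟩
  · have h1 : ∀ s < t, Measurable fun h : History A D t => (extendHistory b h s).1 :=
      fun s _ => measurable_fst.comp (measurable_extendHistory b s)
    have h2 := measurable_armCount b t h1
    have h3 : Measurable fun h : History A D t => cappedSum (fun s => (extendHistory b h s).1)
        (fun s => (extendHistory b h s).2 i - mu b i) b m t :=
      measurable_cappedSum b m t h1 fun s _ => ((measurable_pi_apply i).comp
        (measurable_snd.comp (measurable_extendHistory b s))).sub_const _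
    refine (Real.measurable_exp.comp ((h3.const_mul c).sub ?_)).ennreal_ofReal
    exact (measurable_from_nat (f := fun n : ℕ => c ^ 2 / 2 * ((min n m : ℕ) : ℝ))).comp h2
  · have h1 : ∀ s < t, arm s ω = (extendHistory b (history mu arm noise t ω) s).1 := by
      intro s hs
      simp [extendHistory, hs, history]
    unfold expProcess cappedNoise
    rw [armCount_congr h1, cappedSum_congr h1]
    intro s hs hb
    simp [extendHistory, hs, history, hb]

omit [MeasurableSpace Ω] in
lemma expProcess_succ_of_mem {b : Fin A} {m t : ℕ} {ω : Ω} (hω : ω ∈ cappedEvent arm b m t)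
    (i : Fin D) (c : ℝ) : expProcess arm noise b i m c (t + 1) ω =
      expProcess arm noise b i m c t ω *
        ENNReal.ofReal (Real.exp (c * noise t ω i - c ^ 2 / 2)) := by
  obtain ⟨h1, h2⟩ := hω
  have h3 : armCount (fun s => arm s ω) b (t + 1) = armCount (fun s => arm s ω) b t + 1 := by
    simp [armCount, Nat.count_succ, h1]
  unfold expProcess cappedNoise
  rw [← ENNReal.ofReal_mul (Real.exp_pos _).le, ← Real.exp_add, h3, cappedSum,
    Finset.sum_range_succ, if_pos ⟨h1, h2⟩, min_eq_left h2.le, min_eq_left (by omega), ← cappedSum]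
  push_cast
  ring_nf

omit [MeasurableSpace Ω] in
lemma expProcess_succ_of_notMem {b : Fin A} {m t : ℕ} {ω : Ω} (hω : ω ∉ cappedEvent arm b m t)
    (i : Fin D) (c : ℝ) :
    expProcess arm noise b i m c (t + 1) ω = expProcess arm noise b i m c t ω := by
  have h3 : min (armCount (fun s => arm s ω) b (t + 1)) m =
      min (armCount (fun s => arm s ω) b t) m := by
    by_cases h1 : arm t ω = b
    · have h2 : ¬ armCount (fun s => arm s ω) b t < m := fun h => hω ⟨h1, h⟩
      have h4 := armCount_mono (fun s => arm s ω) b (Nat.le_succ t)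
      rw [Nat.succ_eq_add_one] at h4
      omega
    · simp [armCount, Nat.count_succ, h1]
  unfold expProcess cappedNoise
  rw [h3, cappedSum, Finset.sum_range_succ,
    if_neg (show ¬ (arm t ω = b ∧ armCount (fun s => arm s ω) b t < m) from hω), add_zero, ← cappedSum]

/-- One step changes the process only on `cappedEvent`, where it gains a factor that is independent
of the past and has mean at most 1. -/
lemma IsNOMLEXRun.lintegral_expProcess_le (hrun : IsNOMLEXRun P mu ν eta arm noise)
    (hν : IsNoiseFamily ν) (b : Fin A) (i : Fin D) (m : ℕ) (c : ℝ) (t : ℕ) :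
    ∫⁻ ω, expProcess arm noise b i m c t ω ∂P ≤ 1 := by
  induction t with
  | zero => simp [expProcess, cappedNoise, cappedSum, armCount]
  | succ t ih =>
    have hE := measurableSet_cappedEvent hrun.measurable_arm b m t
    refine le_trans ?_ ih
    rw [← lintegral_add_compl _ hE, ← lintegral_add_compl (expProcess arm noise b i m c t) hE]
    refine add_le_add ?_ (le_of_eq (setLIntegral_congr_fun hE.compl
      fun ω hω => expProcess_succ_of_notMem hω i c))
    obtain ⟨f, hf, hfeq⟩ := exists_expProcess_eq_comp mu arm noise b i m c t
    rw [setLIntegral_congr_fun hE fun ω hω => expProcess_succ_of_mem hω i c]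
    simp only [hfeq]
    rw [cappedEvent_eq mu arm noise, hrun.setLIntegral_mul_noise hν t b
      (measurableSet_pulls_lt b m t) hf
      (g := fun x => ENNReal.ofReal (Real.exp (c * x i - c ^ 2 / 2)))
      (by fun_prop)]
    exact mul_le_of_le_one_right' (hν.lintegral_exp_le b i c)

lemma IsNOMLEXRun.integral_exp_cappedNoise (hrun : IsNOMLEXRun P mu ν eta arm noise)
    (hν : IsNoiseFamily ν) (b : Fin A) (i : Fin D) (m : ℕ) (c : ℝ) (t : ℕ) :
    Integrable (fun ω => Real.exp (c * cappedNoise arm noise b i m t ω)) P ∧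
      ∫ ω, Real.exp (c * cappedNoise arm noise b i m t ω) ∂P ≤ Real.exp (c ^ 2 / 2 * m) := by
  have hmeas : Measurable fun ω => Real.exp (c * cappedNoise arm noise b i m t ω) :=
    ((hrun.measurable_cappedNoise b i m t).const_mul c).exp
  have hle : ∫⁻ ω, ENNReal.ofReal (Real.exp (c * cappedNoise arm noise b i m t ω)) ∂P ≤
      ENNReal.ofReal (Real.exp (c ^ 2 / 2 * m)) := by
    calc ∫⁻ ω, ENNReal.ofReal (Real.exp (c * cappedNoise arm noise b i m t ω)) ∂P
        ≤ ∫⁻ ω, ENNReal.ofReal (Real.exp (c ^ 2 / 2 * m)) *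
            expProcess arm noise b i m c t ω ∂P := by
          refine lintegral_mono fun ω => ?_
          unfold expProcess
          rw [← ENNReal.ofReal_mul (Real.exp_pos _).le, ← Real.exp_add]
          refine ENNReal.ofReal_le_ofReal (Real.exp_le_exp.2 ?_)
          have h1 : ((min (armCount (fun s => arm s ω) b t) m : ℕ) : ℝ) ≤ m :=
            Nat.cast_le.2 (min_le_right _ _)
          have h2 := mul_le_mul_of_nonneg_left h1 (by positivity : 0 ≤ c ^ 2 / 2)
          linarith
      _ = ENNReal.ofReal (Real.exp (c ^ 2 / 2 * m)) *
            ∫⁻ ω, expProcess arm noise b i m c t ω ∂P :=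
          lintegral_const_mul' _ _ ENNReal.ofReal_ne_top
      _ ≤ _ := mul_le_of_le_one_right' (hrun.lintegral_expProcess_le hν b i m c t)
  constructor
  · refine ⟨hmeas.aestronglyMeasurable, ?_⟩
    rw [hasFiniteIntegral_iff_ofReal (ae_of_all _ fun ω => (Real.exp_pos _).le)]
    exact hle.trans_lt ENNReal.ofReal_lt_top
  · rw [integral_eq_lintegral_of_nonneg_ae (ae_of_all _ fun ω => (Real.exp_pos _).le)
      hmeas.aestronglyMeasurable]
    exact ENNReal.toReal_le_of_le_ofReal (Real.exp_pos _).le hle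

/-- Chernoff's bound; the sign of `c` selects the upper or the lower tail. -/
lemma IsNOMLEXRun.prob_cappedNoise_le (hrun : IsNOMLEXRun P mu ν eta arm noise)
    (hν : IsNoiseFamily ν) (b : Fin A) (i : Fin D) (m : ℕ) (c : ℝ) (t : ℕ) :
    P.real {ω | c ^ 2 * m ≤ c * cappedNoise arm noise b i m t ω} ≤
      Real.exp (-(c ^ 2 / 2 * m)) := by
  obtain ⟨h1, h2⟩ := hrun.integral_exp_cappedNoise hν b i m c t
  have h3 := mul_meas_ge_le_integral_of_nonneg
    (ae_of_all P fun ω => (Real.exp_pos (c * cappedNoise arm noise b i m t ω)).le) h1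
    (Real.exp (c ^ 2 * m))
  simp only [Real.exp_le_exp] at h3
  have h4 := h3.trans h2
  rw [← le_div_iff₀' (Real.exp_pos _), ← Real.exp_sub] at h4
  refine h4.trans (le_of_eq ?_)
  ring_nf

/-- A sharpened Chernoff bound: Markov's inequality is applied to `exp y` minus its tangent line at
`y = -1`. The difference is nonnegative and increasing for `y ≥ 0`, and as the noise has mean zero,
the tangent line lowers the expectation by `2 / e`. -/
lemma IsNOMLEXRun.prob_cappedNoise_mul_le (hrun : IsNOMLEXRun P mu ν eta arm noise)
    (hν : IsNoiseFamily ν) (b : Fin A) (i : Fin D) (m : ℕ) (c : ℝ) (t : ℕ) :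
    P.real {ω | c ^ 2 * m ≤ c * cappedNoise arm noise b i m t ω} *
        (Real.exp (c ^ 2 * m) - Real.exp (-1) * (2 + c ^ 2 * m)) ≤
      Real.exp (c ^ 2 / 2 * m) - Real.exp (-1) * 2 := by
  obtain ⟨h1, h2⟩ := hrun.integral_exp_cappedNoise hν b i m c t
  obtain ⟨h3, h4⟩ := hrun.integral_cappedNoise hν b i m t
  have hnonneg : ∀ y : ℝ, 0 ≤ Real.exp y - Real.exp (-1) * (2 + y) := by
    intro y
    have h := Real.add_one_le_exp (y + 1)
    have h' : Real.exp y = Real.exp (-1) * Real.exp (y + 1) := by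
      rw [← Real.exp_add]
      ring_nf
    rw [h', ← mul_sub]
    exact mul_nonneg (Real.exp_pos _).le (by linarith)
  have hmono : ∀ y z : ℝ, 0 ≤ y → y ≤ z →
      Real.exp y - Real.exp (-1) * (2 + y) ≤ Real.exp z - Real.exp (-1) * (2 + z) := by
    intro y z hy hyz
    have e1 : Real.exp z = Real.exp y * Real.exp (z - y) := by
      rw [← Real.exp_add]
      ring_nf
    have e2 := Real.add_one_le_exp (z - y)
    have e3 : Real.exp (-1) ≤ Real.exp y := Real.exp_le_exp.2 (by linarith)
    have e4 := mul_le_mul_of_nonneg_left e2 (Real.exp_pos y).le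
    have e5 := mul_le_mul_of_nonneg_right e3 (sub_nonneg.2 hyz)
    rw [e1]
    linarith
  set Y : Ω → ℝ := fun ω => c * cappedNoise arm noise b i m t ω with hY
  have hYint : Integrable Y P := h3.const_mul c
  have hY0 : ∫ ω, Y ω ∂P = 0 := by
    simp only [hY, integral_const_mul, h4, mul_zero]
  have hlin : Integrable (fun ω => Real.exp (-1) * (2 + Y ω)) P :=
    ((integrable_const 2).add hYint).const_mul _
  have hint : Integrable (fun ω => Real.exp (Y ω) - Real.exp (-1) * (2 + Y ω)) P := h1.sub hlin
  have hval : ∫ ω, (Real.exp (Y ω) - Real.exp (-1) * (2 + Y ω)) ∂P =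
      ∫ ω, Real.exp (Y ω) ∂P - Real.exp (-1) * 2 := by
    rw [integral_sub h1 hlin, integral_const_mul, integral_add (integrable_const 2) hYint, hY0]
    simp [hY]
  have h5 := mul_meas_ge_le_integral_of_nonneg (ae_of_all P fun ω => hnonneg (Y ω)) hint
    (Real.exp (c ^ 2 * m) - Real.exp (-1) * (2 + c ^ 2 * m))
  have h6 : P.real {ω | c ^ 2 * m ≤ Y ω} ≤
      P.real {ω | Real.exp (c ^ 2 * m) - Real.exp (-1) * (2 + c ^ 2 * m) ≤
        Real.exp (Y ω) - Real.exp (-1) * (2 + Y ω)} :=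
    measureReal_mono fun ω hω => hmono _ _ (by positivity) hω
  have h7 := mul_le_mul_of_nonneg_right h6 (hnonneg (c ^ 2 * m))
  rw [hval] at h5
  linarith

end Run

/-! ### Numerical estimates for the two series. -/

section Numeric

/-- The minimum is at `x ^ 2 = 1 / e`; `log y ≤ y - 1` at `y = 1 / (e x ^ 2)` gives it. -/
lemma neg_le_sq_mul_log {x : ℝ} (hx : 0 < x) :
    -(1 / (2 * Real.exp 1)) ≤ x ^ 2 * Real.log x := by
  have h1 := Real.log_le_sub_one_of_pos (x := (Real.exp 1 * x ^ 2)⁻¹) (by positivity)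
  rw [Real.log_inv, Real.log_mul (by positivity) (by positivity), Real.log_exp, Real.log_pow] at h1
  have he := Real.exp_pos 1
  have h2 : (Real.exp 1 * x ^ 2)⁻¹ * x ^ 2 = 1 / Real.exp 1 := by field_simp
  have h3 : 1 / (2 * Real.exp 1) = 1 / Real.exp 1 / 2 := by field_simp
  have h4 := mul_le_mul_of_nonneg_right h1 (sq_nonneg x)
  push_cast at h4
  rw [h3, ← h2]
  linarith

lemma log_term_lower_bound {c : ℝ} (hc : 0 < c) :
    -(24 / 1000) ≤ 36 / c ^ 2 * Real.log (17 / c) := by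
  have h := neg_le_sq_mul_log (x := 17 / c) (by positivity)
  have h1 : 36 / c ^ 2 * Real.log (17 / c) = 36 / 289 * ((17 / c) ^ 2 * Real.log (17 / c)) := by
    field_simp
    ring
  have h2 : 1 / (2 * Real.exp 1) ≤ 1 / 5.4 := by
    have := Real.exp_one_gt_d9
    exact one_div_le_one_div_of_le (by norm_num) (by linarith)
  rw [h1]
  linarith

lemma sum_exp_neg_le {c : ℝ} (hc : 0 < c) (T : ℕ) :
    ∑ n ∈ Finset.Icc 1 T, Real.exp (-(n * c)) ≤ 1 / (Real.exp c - 1) := by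
  have h1 : 1 < Real.exp c := Real.one_lt_exp_iff.2 hc
  have key : ∀ T : ℕ, ∑ n ∈ Finset.Icc 1 T, Real.exp (-(n * c)) =
      (1 - Real.exp (-(T * c))) / (Real.exp c - 1) := by
    intro T
    induction T with
    | zero => simp
    | succ T ih =>
      rw [Finset.sum_Icc_succ_top (by omega), ih]
      have h2 : Real.exp c - 1 ≠ 0 := by linarith
      have h3 : Real.exp (-(T * c)) = Real.exp (-((T + 1 : ℕ) * c)) * Real.exp c := by
        rw [← Real.exp_add]
        push_cast
        ring_nf
      rw [h3]
      field_simp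
      ring
  rw [key]
  have := Real.exp_pos (-(T * c))
  gcongr
  linarith

/-- By `log y ≤ y - 1` at `y = n (c / 12) ^ 2`, `log n` is at most `n c ^ 2 / 144 + 2 log (12 / c) -
1`. The threshold is what makes this at most `n c ^ 2 / 16`. -/
lemma log_le_of_threshold {c : ℝ} (hc : 0 < c) {n : ℕ} (hn : 1 ≤ n)
    (h : 36 / c ^ 2 * (Real.log (12 / c) - 1 / 2) ≤ n) :
    4 * Real.log n / n ≤ (c / 2) ^ 2 := by
  have hn0 : (0 : ℝ) < n := by positivity
  have h1 := Real.log_le_sub_one_of_pos (x := n * (c / 12) ^ 2) (by positivity)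
  rw [Real.log_mul (by positivity) (by positivity), Real.log_pow] at h1
  have h2 : Real.log (12 / c) = - Real.log (c / 12) := by
    rw [← Real.log_inv, inv_div]
  rw [h2, div_mul_eq_mul_div, div_le_iff₀ (by positivity)] at h
  rw [div_le_iff₀ hn0]
  push_cast at h1
  nlinarith

lemma log_le_of_large {c : ℝ} (hc : 8 ≤ c) {n : ℕ} (hn : 1 ≤ n) :
    4 * Real.log n / n ≤ (c / 2) ^ 2 := by
  have hn0 : (0 : ℝ) < n := by positivity
  have h1 := Real.log_le_sub_one_of_pos hn0
  rw [div_le_iff₀ hn0]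
  have h2 : (4 : ℝ) ≤ (c / 2) ^ 2 := by nlinarith
  nlinarith

lemma sum_exploit_prob_le {c : ℝ} (hc : 0 < c) (T : ℕ) (p : ℕ → ℝ) (hp1 : ∀ n : ℕ, p n ≤ 1)
    (hp : ∀ n : ℕ, 1 ≤ n → 4 * Real.log n / n ≤ (c / 2) ^ 2 → p n ≤ Real.exp (-(n * (c ^ 2 / 8)))) :
    ∑ n ∈ Finset.Icc 1 T, p n ≤ 36 / c ^ 2 * Real.log (17 / c) + 25 / 1000 := by
  -- For `c ≥ 8` every `n` is in the exponential regime and the series is at most `1 / 1000`, while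
  -- the logarithmic term is at least `-24 / 1000`; this is the source of the extra `25 / 1000`.
  rcases le_or_gt 8 c with h8 | h8
  · have h1 : ∑ n ∈ Finset.Icc 1 T, p n ≤ ∑ n ∈ Finset.Icc 1 T, Real.exp (-(n * (c ^ 2 / 8))) :=
      Finset.sum_le_sum fun n hn =>
        hp n (Finset.mem_Icc.1 hn).1 (log_le_of_large h8 (Finset.mem_Icc.1 hn).1)
    have h2 := sum_exp_neg_le (c := c ^ 2 / 8) (by positivity) T
    have h3 : (1001 : ℝ) ≤ Real.exp (c ^ 2 / 8) := by
      calc (1001 : ℝ) ≤ 2.7 ^ 8 := by norm_num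
        _ ≤ Real.exp 1 ^ 8 := by
            have := Real.exp_one_gt_d9
            gcongr
            linarith
        _ = Real.exp 8 := by rw [← Real.exp_nat_mul]; norm_num
        _ ≤ Real.exp (c ^ 2 / 8) := Real.exp_le_exp.2 (by nlinarith)
    have h4 : 1 / (Real.exp (c ^ 2 / 8) - 1) ≤ 1 / 1000 :=
      one_div_le_one_div_of_le (by norm_num) (by linarith)
    have h5 := log_term_lower_bound hc
    linarith
  · set L := 36 / c ^ 2 * (Real.log (12 / c) - 1 / 2) with hL
    have h1 : ∑ n ∈ Finset.Icc 1 T, p n ≤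
        ∑ n ∈ Finset.Icc 1 T, ((if (n : ℝ) < L then 1 else 0) + Real.exp (-(n * (c ^ 2 / 8)))) := by
      refine Finset.sum_le_sum fun n hn => ?_
      have hn1 := (Finset.mem_Icc.1 hn).1
      split_ifs with h
      · have := Real.exp_pos (-(n * (c ^ 2 / 8)))
        linarith [hp1 n]
      · rw [zero_add]
        exact hp n hn1 (log_le_of_threshold hc hn1 (not_lt.1 h))
    have h2 : ∑ n ∈ Finset.Icc 1 T, (if (n : ℝ) < L then (1 : ℝ) else 0) ≤ max L 0 := by
      rw [← Finset.sum_filter, Finset.sum_const, nsmul_eq_mul, mul_one]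
      have : ((Finset.Icc 1 T).filter fun n : ℕ => (n : ℝ) < L) ⊆ Finset.Icc 1 ⌊max L 0⌋₊ := by
        intro n hn
        obtain ⟨h1, h2⟩ := Finset.mem_filter.1 hn
        exact Finset.mem_Icc.2 ⟨(Finset.mem_Icc.1 h1).1, Nat.le_floor (h2.le.trans (le_max_left _ _))⟩
      refine (Nat.cast_le.2 (Finset.card_le_card this)).trans ?_
      rw [Nat.card_Icc, Nat.add_sub_cancel]
      exact Nat.floor_le (le_max_right _ _)
    have h3 := sum_exp_neg_le (c := c ^ 2 / 8) (by positivity) T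
    have h4 : 1 / (Real.exp (c ^ 2 / 8) - 1) ≤ 1 / (c ^ 2 / 8) :=
      one_div_le_one_div_of_le (by positivity) (by linarith [Real.add_one_le_exp (c ^ 2 / 8)])
    -- The tail is `2 / 9` in units of `36 / c ^ 2`. If `L ≤ 0`, then `c < 8` gives `log (17 / c) ≥
    -- 1 - 8 / 17`, which exceeds `2 / 9`; otherwise replacing 12 by 17 in the logarithm and
    -- dropping `-1 / 2` more than pays for it.
    have h5 : max L 0 + 1 / (c ^ 2 / 8) ≤ 36 / c ^ 2 * Real.log (17 / c) := by
      have e1 : 1 / (c ^ 2 / 8) = 36 / c ^ 2 * (8 / 36) := by field_simp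
      rcases le_total L 0 with h | h
      · rw [max_eq_right h, zero_add, e1]
        gcongr
        have h6 := Real.one_sub_inv_le_log_of_pos (x := 17 / c) (by positivity)
        rw [inv_div] at h6
        linarith
      · rw [max_eq_left h, e1, hL, ← mul_add]
        gcongr
        have h6 := Real.one_sub_inv_le_log_of_pos (x := 17 / 12) (by norm_num)
        have h7 : Real.log (17 / c) = Real.log (12 / c) + Real.log (17 / 12) := by
          rw [← Real.log_mul (by positivity) (by positivity)]
          congr 1
          field_simp
        norm_num at h6
        linarith
    rw [Finset.sum_add_distrib] at h1
    linarith

/-- The bound for the probability that the optimal arm fails one of the tests at its `m`-th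
selection; it is `1 / m ^ 2` with a small gain at `m = 2` and `m = 3`. -/
noncomputable def failureBound (m : ℕ) : ℝ :=
  1 / (m : ℝ) ^ 2 - ((if m = 2 then 20 / 1000 else 0) + (if m = 3 then 5 / 1000 else 0))

lemma failureBound_nonneg (m : ℕ) : 0 ≤ failureBound m := by
  unfold failureBound
  by_cases h2 : m = 2
  · subst h2; norm_num
  · by_cases h3 : m = 3
    · subst h3; norm_num
    · simp [h2, h3]

lemma sum_failureBound_le (T : ℕ) :
    ∑ m ∈ Finset.Icc 1 T, failureBound m ≤ Real.pi ^ 2 / 6 - 25 / 1000 := by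
  have h : HasSum failureBound (Real.pi ^ 2 / 6 - (20 / 1000 + 5 / 1000)) :=
    hasSum_zeta_two.sub ((hasSum_ite_eq 2 _).add (hasSum_ite_eq 3 _))
  have := sum_le_hasSum (Finset.Icc 1 T) (fun m _ => failureBound_nonneg m) h
  linarith

/-- The hypotheses are the plain and the sharpened Chernoff bounds at the confidence radius. The
second is used only for `m = 2` and `m = 3`. -/
lemma le_failureBound {p : ℝ} {m : ℕ} (hm : 1 ≤ m)
    (h1 : p ≤ Real.exp (-(2 * Real.log m)))
    (h2 : p * (Real.exp (4 * Real.log m) - Real.exp (-1) * (2 + 4 * Real.log m)) ≤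
      Real.exp (2 * Real.log m) - Real.exp (-1) * 2) : p ≤ failureBound m := by
  have hm0 : (0 : ℝ) < m := by positivity
  have e2 : Real.exp (2 * Real.log m) = (m : ℝ) ^ 2 := by
    rw [mul_comm, Real.exp_mul, Real.exp_log hm0]; norm_cast
  have e4 : Real.exp (4 * Real.log m) = (m : ℝ) ^ 4 := by
    rw [mul_comm, Real.exp_mul, Real.exp_log hm0]; norm_cast
  have he1 : 0.3678 ≤ Real.exp (-1) := by linarith [Real.exp_neg_one_gt_d9]
  have he2 : Real.exp (-1) ≤ 0.3679 := by linarith [Real.exp_neg_one_lt_d9]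
  have l2 := Real.log_two_lt_d9
  rw [e2, e4] at h2
  rw [Real.exp_neg, e2] at h1
  unfold failureBound
  by_cases m2 : m = 2
  · subst m2
    norm_num at h2 ⊢
    by_contra hp
    have : Real.exp (-1) * (2 + 4 * Real.log 2) ≤ 0.3679 * (2 + 4 * 0.6932) := by
      gcongr
      linarith
    nlinarith
  · by_cases m3 : m = 3
    · subst m3
      have l3 : Real.log 3 ≤ 1.2 := by
        have : Real.log (3 / 2) ≤ 3 / 2 - 1 := Real.log_le_sub_one_of_pos (by norm_num)
        rw [Real.log_div (by norm_num) (by norm_num)] at this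
        linarith
      norm_num at h2 ⊢
      by_contra hp
      have : Real.exp (-1) * (2 + 4 * Real.log 3) ≤ 0.3679 * (2 + 4 * 1.2) := by
        gcongr
      nlinarith
    · simpa [m2, m3] using h1

end Numeric

/-! ### Expected number of selections and the regret. -/

section Regret

variable {A D : ℕ} {Ω : Type*} [MeasurableSpace Ω] {P : Measure Ω} [IsProbabilityMeasure P]
  {mu : Fin A → Fin D → ℝ} {ν : Fin A → Measure (Fin D → ℝ)} {eta : Fin D → ℝ}
  {arm : ℕ → Ω → Fin A} {noise : ℕ → Ω → Fin D → ℝ}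

lemma lt_gap_of_mem_lexSuboptimal {star a : Fin A} {i : Fin D} {e : ℝ}
    (he : ((mu star i : ℝ) : EReal) - minGap mu star i < (e : EReal))
    (ha : a ∈ lexSuboptimal mu i) : mu star i - e < gap mu star a i := by
  have h1 : minGap mu star i ≤ ((gap mu star a i : ℝ) : EReal) := iInf₂_le a ha
  have h2 := (EReal.sub_le_sub (le_refl ((mu star i : ℝ) : EReal)) h1).trans_lt he
  rw [← EReal.coe_sub, EReal.coe_lt_coe_iff] at h2
  linarith

lemma mem_estOptimal_prefixHistory (mu : Fin A → Fin D → ℝ) (eta : Fin D → ℝ)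
    (arm : ℕ → Fin A) (z : ℕ → Fin D → ℝ) (b : Fin A) {m t T : ℕ} (htT : t ≤ T)
    (hm : armCount arm b t = m) (hm1 : 1 ≤ m) :
    b ∈ estOptimal eta (prefixHistory (fun s => (arm s, fun i => mu (arm s) i + z s i)) t) ↔
      ∀ i, m * (eta i - mu b i - √(4 * Real.log m / m)) < cappedSum arm (fun s => z s i) b m T := by
  have hm0 : (0 : ℝ) < m := by positivity
  simp only [estOptimal, Finset.mem_filter, Finset.mem_univ, true_and]
  refine forall_congr' fun i => ?_
  rw [sampleMean_prefixHistory arm mu z b i htT hm hm1, pulls_prefixHistory, hm,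
    ← lt_div_iff₀' hm0]
  constructor <;> intro h <;> linarith

/-- The event that the first `m` rewards of arm `b` fall below the mean by the confidence radius
in some objective. -/
def failureEvent (arm : ℕ → Ω → Fin A) (noise : ℕ → Ω → Fin D → ℝ) (b : Fin A) (T m : ℕ) : Set Ω :=
  {ω | ∃ i, cappedNoise arm noise b i m T ω ≤ -(m * √(4 * Real.log m / m))}

lemma IsNOMLEXRun.prob_failureEvent_le (hrun : IsNOMLEXRun P mu ν eta arm noise)
    (hν : IsNoiseFamily ν) (b : Fin A) (T : ℕ) {m : ℕ} (hm : 1 ≤ m) :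
    P.real (failureEvent arm noise b T m) ≤ D * failureBound m := by
  have hm0 : (0 : ℝ) < m := by positivity
  have hlog : 0 ≤ Real.log m := Real.log_nonneg (by exact_mod_cast hm)
  set r := √(4 * Real.log m / m) with hr
  have hr0 : 0 ≤ r := Real.sqrt_nonneg _
  -- The tail bounds are used with `c = -r`, so that the plain one gives `exp (-2 log m) = 1 / m ^
  -- 2`.
  have hr2 : (-r) ^ 2 * m = 4 * Real.log m := by
    rw [neg_sq, hr, Real.sq_sqrt (by positivity)]
    field_simp
  have hr3 : (-r) ^ 2 / 2 * m = 2 * Real.log m := by linarith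
  have hi : ∀ i : Fin D, P.real {ω | cappedNoise arm noise b i m T ω ≤ -(m * r)} ≤
      failureBound m := by
    intro i
    have h1 := hrun.prob_cappedNoise_le hν b i m (-r) T
    have h2 := hrun.prob_cappedNoise_mul_le hν b i m (-r) T
    rw [hr3] at h1 h2
    rw [hr2] at h2
    refine le_trans (measureReal_mono fun ω hω => ?_) (le_failureBound hm h1 (by rwa [hr2]))
    have hle : cappedNoise arm noise b i m T ω ≤ -(m * r) := hω
    have := mul_le_mul_of_nonneg_left hle hr0
    simp only [Set.mem_ofPred_eq]
    linarith
  have hU : failureEvent arm noise b T m =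
      ⋃ i : Fin D, {ω | cappedNoise arm noise b i m T ω ≤ -(m * r)} := by
    ext ω
    simp [failureEvent, hr]
  rw [hU]
  calc P.real (⋃ i : Fin D, {ω | cappedNoise arm noise b i m T ω ≤ -(m * r)})
      ≤ ∑ i : Fin D, P.real {ω | cappedNoise arm noise b i m T ω ≤ -(m * r)} :=
        measureReal_iUnion_fintype_le _
    _ ≤ ∑ _i : Fin D, failureBound m := Finset.sum_le_sum fun i _ => hi i
    _ = D * failureBound m := by simp

/-- The event that the first `m` rewards of arm `b` in objective `j` exceed the mean by more than
`c` minus the confidence radius. -/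
def overestimateEvent (arm : ℕ → Ω → Fin A) (noise : ℕ → Ω → Fin D → ℝ) (b : Fin A) (j : Fin D)
    (c : ℝ) (T m : ℕ) : Set Ω :=
  {ω | m * (c - √(4 * Real.log m / m)) < cappedNoise arm noise b j m T ω}

lemma IsNOMLEXRun.prob_overestimateEvent_le (hrun : IsNOMLEXRun P mu ν eta arm noise)
    (hν : IsNoiseFamily ν) (b : Fin A) (j : Fin D) {c : ℝ} (hc : 0 < c) (T m : ℕ)
    (hm : 4 * Real.log m / m ≤ (c / 2) ^ 2) :
    P.real (overestimateEvent arm noise b j c T m) ≤ Real.exp (-(m * (c ^ 2 / 8))) := by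
  have h1 := hrun.prob_cappedNoise_le hν b j m (c / 2) T
  have h2 : √(4 * Real.log m / m) ≤ c / 2 := Real.sqrt_le_iff.2 ⟨by positivity, hm⟩
  refine le_trans (measureReal_mono fun ω hω => ?_) (h1.trans (le_of_eq ?_))
  · have h3 : m * (c - √(4 * Real.log m / m)) < cappedNoise arm noise b j m T ω := hω
    have h4 : (m : ℝ) * (c / 2) ≤ m * (c - √(4 * Real.log m / m)) :=
      mul_le_mul_of_nonneg_left (by linarith) (Nat.cast_nonneg m)
    have h5 := mul_le_mul_of_nonneg_left (h4.trans h3.le) (by positivity : 0 ≤ c / 2)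
    simp only [Set.mem_ofPred_eq]
    linarith
  · congr 1
    ring

lemma IsNOMLEXRun.integrable_armCount (hrun : IsNOMLEXRun P mu ν eta arm noise) (a : Fin A)
    (T : ℕ) : Integrable (fun ω => (armCount (fun s => arm s ω) a T : ℝ)) P := by
  refine Integrable.of_bound (C := (T : ℝ)) ?_ (ae_of_all _ fun ω => ?_)
  · exact (measurable_from_nat.comp
      (measurable_armCount a T fun s _ => hrun.measurable_arm s)).aestronglyMeasurable
  · rw [Real.norm_of_nonneg (Nat.cast_nonneg _)]
    exact Nat.cast_le.2 (armCount_le _ _ _)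

open Classical in
omit [MeasurableSpace Ω] in
lemma armCount_le_sum_indicator {star a : Fin A} {ω : Ω} (heta : ∀ i, eta i ≤ mu star i)
    (hω : Follows eta fun s => (arm s ω, fun i => mu (arm s ω) i + noise s ω i)) (j : Fin D)
    (T : ℕ) :
    (armCount (fun s => arm s ω) a T : ℝ) ≤ 1 +
      ∑ m ∈ Finset.Icc 1 T, (failureEvent arm noise star T m).indicator 1 ω +
      ∑ m ∈ Finset.Icc 1 T,
        (overestimateEvent arm noise a j (eta j - mu a j) T m).indicator 1 ω := by
  have h := armCount_le_of_follows hω a star T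
  have h1 : ∀ {p q : ℕ → Prop} {_ : DecidablePred p} {_ : DecidablePred q},
      (∀ m, 1 ≤ m → p m → q m) →
      (((Finset.Icc 1 T).filter p).card : ℝ) ≤
        ∑ m ∈ Finset.Icc 1 T, if q m then (1 : ℝ) else 0 := by
    intro p q _ _ hpq
    rw [Finset.card_filter, Nat.cast_sum]
    refine Finset.sum_le_sum fun m hm => ?_
    by_cases hp : p m
    · simp [hp, hpq m (Finset.mem_Icc.1 hm).1 hp]
    · simp only [hp, if_false, Nat.cast_zero]
      split_ifs <;> norm_num
  have hF : ∀ m, 1 ≤ m → (∃ t < T, armCount (fun s => arm s ω) star t = m ∧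
      star ∉ estOptimal eta (prefixHistory
        (fun s => (arm s ω, fun i => mu (arm s ω) i + noise s ω i)) t)) →
      ω ∈ failureEvent arm noise star T m := by
    rintro m hm ⟨t, ht, hc, hs⟩
    rw [mem_estOptimal_prefixHistory mu eta _ (fun s => noise s ω) star ht.le hc hm] at hs
    push Not at hs
    obtain ⟨i, hi⟩ := hs
    refine ⟨i, le_trans hi ?_⟩
    have := mul_le_mul_of_nonneg_left (sub_nonpos.2 (heta i)) (Nat.cast_nonneg (α := ℝ) m)
    linarith
  have hG : ∀ m, 1 ≤ m → (∃ t < T, armCount (fun s => arm s ω) a t = m ∧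
      a ∈ estOptimal eta (prefixHistory
        (fun s => (arm s ω, fun i => mu (arm s ω) i + noise s ω i)) t)) →
      ω ∈ overestimateEvent arm noise a j (eta j - mu a j) T m := by
    rintro m hm ⟨t, ht, hc, hs⟩
    rw [mem_estOptimal_prefixHistory mu eta _ (fun s => noise s ω) a ht.le hc hm] at hs
    exact hs j
  simp only [Set.indicator, Pi.one_apply]
  refine (Nat.cast_le (α := ℝ).2 h).trans ?_
  push_cast
  exact add_le_add (add_le_add le_rfl (h1 hF)) (h1 hG)

lemma IsNOMLEXRun.integral_armCount_le (hrun : IsNOMLEXRun P mu ν eta arm noise)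
    (hν : IsNoiseFamily ν) {star : Fin A} (heta : ∀ i, eta i ≤ mu star i) (a : Fin A)
    (j : Fin D) {c : ℝ} (hc : c = eta j - mu a j) (hc0 : 0 < c) (T : ℕ) :
    ∫ ω, (armCount (fun s => arm s ω) a T : ℝ) ∂P ≤
      Real.pi ^ 2 / 6 * D + 1 + 36 / c ^ 2 * Real.log (17 / c) := by
  have hFm : ∀ m, MeasurableSet (failureEvent arm noise star T m) := by
    intro m
    have : failureEvent arm noise star T m =
        ⋃ i : Fin D, {ω | cappedNoise arm noise star i m T ω ≤ -(m * √(4 * Real.log m / m))} := by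
      ext ω
      simp [failureEvent]
    rw [this]
    exact MeasurableSet.iUnion fun i =>
      measurableSet_le (hrun.measurable_cappedNoise star i m T) measurable_const
  have hGm : ∀ m, MeasurableSet (overestimateEvent arm noise a j c T m) := fun m =>
    measurableSet_lt measurable_const (hrun.measurable_cappedNoise a j m T)
  have hind : ∀ {s : Set Ω}, MeasurableSet s → Integrable (s.indicator (1 : Ω → ℝ)) P :=
    fun hs => (integrable_const (1 : ℝ)).indicator hs
  have hintF := integrable_finsetSum (μ := P) (Finset.Icc 1 T) fun m _ => hind (hFm m)
  have hintG := integrable_finsetSum (μ := P) (Finset.Icc 1 T) fun m _ => hind (hGm m)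
  have h1 : ∫ ω, (armCount (fun s => arm s ω) a T : ℝ) ∂P ≤
      ∫ ω, (1 + ∑ m ∈ Finset.Icc 1 T, (failureEvent arm noise star T m).indicator 1 ω +
        ∑ m ∈ Finset.Icc 1 T, (overestimateEvent arm noise a j c T m).indicator 1 ω) ∂P := by
    refine integral_mono_ae (hrun.integrable_armCount a T)
      (((integrable_const 1).add hintF).add hintG) ?_
    filter_upwards [hrun.ae_follows] with ω hω
    rw [hc]
    exact armCount_le_sum_indicator heta hω j T
  have hint1F : Integrable (fun ω => 1 +
      ∑ m ∈ Finset.Icc 1 T, (failureEvent arm noise star T m).indicator (1 : Ω → ℝ) ω) P :=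
    (integrable_const 1).add hintF
  rw [integral_add hint1F hintG, integral_add (integrable_const 1) hintF,
    integral_finsetSum _ fun m _ => hind (hFm m), integral_finsetSum _ fun m _ => hind (hGm m)]
    at h1
  simp only [integral_indicator_one (hFm _), integral_indicator_one (hGm _), integral_const,
    probReal_univ, smul_eq_mul, mul_one] at h1
  have h2 : ∑ m ∈ Finset.Icc 1 T, P.real (failureEvent arm noise star T m) ≤
      D * (Real.pi ^ 2 / 6 - 25 / 1000) := by
    refine (Finset.sum_le_sum fun m hm =>
      hrun.prob_failureEvent_le hν star T (Finset.mem_Icc.1 hm).1).trans ?_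
    rw [← Finset.mul_sum]
    exact mul_le_mul_of_nonneg_left (sum_failureBound_le T) (Nat.cast_nonneg D)
  have h3 := sum_exploit_prob_le hc0 T
    (fun m => P.real (overestimateEvent arm noise a j c T m)) (fun m => measureReal_le_one)
    (fun m _ hm => hrun.prob_overestimateEvent_le hν a j hc0 T m hm)
  -- With `D ≥ 1`, the gain `D * 25 / 1000` in `h2` covers the excess `25 / 1000` in `h3`.
  have hD : (1 : ℝ) ≤ D := by exact_mod_cast j.pos
  linarith

omit [MeasurableSpace Ω] in
lemma regretPB_eq_sum (mu : Fin A → Fin D → ℝ) (star : Fin A) (arm : ℕ → Ω → Fin A) (i : Fin D)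
    (T : ℕ) (ω : Ω) : regretPB mu star arm i T ω =
      ∑ a ∈ lexSuboptimal mu i, (armCount (fun s => arm s ω) a T : ℝ) * gap mu star a i := by
  classical
  simp only [armCount, Nat.count_eq_card_filter_range, Finset.card_filter, Nat.cast_sum,
    Finset.sum_mul]
  rw [Finset.sum_comm]
  refine Finset.sum_congr rfl fun t _ => ?_
  simp

end Regret

end LexBandit

theorem theorem2 {A D : ℕ} {Ω : Type*} [MeasurableSpace Ω] (P : Measure Ω)
    [IsProbabilityMeasure P]
    (mu : Fin A → Fin D → ℝ) (ν : Fin A → Measure (Fin D → ℝ)) (hν : IsNoiseFamily ν)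
    (star : Fin A) (hstar : star ∈ lexOptimal mu D)
    (eta delta : Fin D → ℝ)
    (heta_lower : ∀ i, ((mu star i : ℝ) : EReal) - minGap mu star i < ((eta i : ℝ) : EReal))
    (heta_upper : ∀ i, eta i < mu star i)
    (hdelta : ∀ i, delta i = mu star i - eta i)
    (arm : ℕ → Ω → Fin A) (noise : ℕ → Ω → Fin D → ℝ)
    (hrun : IsNOMLEXRun P mu ν eta arm noise) (i : Fin D) :
    (∀ T : ℕ, Integrable (regretPB mu star arm i T) P ∧
      ∫ ω, regretPB mu star arm i T ω ∂P ≤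
        ∑ a ∈ lexSuboptimal mu i,
          ((Real.pi ^ 2 / 6 * D + 1) * gap mu star a i +
            36 * gap mu star a i / (⨆ j : Fin D, (gap mu star a j - delta j)) ^ 2 *
              Real.log (17 / (⨆ j : Fin D, (gap mu star a j - delta j))))) ∧
    BddAbove (Set.range fun T : ℕ => ∫ ω, regretPB mu star arm i T ω ∂P) := by
  have hmain : ∀ T : ℕ, Integrable (regretPB mu star arm i T) P ∧
      ∫ ω, regretPB mu star arm i T ω ∂P ≤
        ∑ a ∈ lexSuboptimal mu i,
          ((Real.pi ^ 2 / 6 * D + 1) * gap mu star a i +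
            36 * gap mu star a i / (⨆ j : Fin D, (gap mu star a j - delta j)) ^ 2 *
              Real.log (17 / (⨆ j : Fin D, (gap mu star a j - delta j)))) := by
    intro T
    have hterm : ∀ a, Integrable
        (fun ω => (armCount (fun s => arm s ω) a T : ℝ) * gap mu star a i) P :=
      fun a => (hrun.integrable_armCount a T).mul_const _
    have heq : regretPB mu star arm i T = fun ω =>
        ∑ a ∈ lexSuboptimal mu i, (armCount (fun s => arm s ω) a T : ℝ) * gap mu star a i :=
      funext fun ω => regretPB_eq_sum mu star arm i T ω
    simp only [heq]
    refine ⟨integrable_finsetSum _ fun a _ => hterm a, ?_⟩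
    rw [integral_finsetSum _ fun a _ => hterm a]
    refine Finset.sum_le_sum fun a ha => ?_
    rw [integral_mul_const]
    have hgap := lt_gap_of_mem_lexSuboptimal (heta_lower i) ha
    have hgap0 : 0 < gap mu star a i := (sub_pos.2 (heta_upper i)).trans hgap
    have : Nonempty (Fin D) := ⟨i⟩
    set c := ⨆ j : Fin D, (gap mu star a j - delta j) with hc
    -- The test in the maximizing objective `j` is the one used against `a`; objective `i` only
    -- shows that the maximum is positive.
    obtain ⟨j, hj⟩ := exists_eq_ciSup_of_finite (f := fun j => gap mu star a j - delta j)
    have hci : gap mu star a i - delta i ≤ c :=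
      le_ciSup (f := fun j => gap mu star a j - delta j) (Set.finite_range _).bddAbove i
    have hc0 : 0 < c := by
      rw [hdelta i] at hci
      linarith
    have hcj : c = eta j - mu a j := by
      rw [hc, ← hj, hdelta j, gap]
      ring
    have h1 := mul_le_mul_of_nonneg_right
      (hrun.integral_armCount_le hν (fun i => (heta_upper i).le) a j hcj hc0 T) hgap0.le
    refine h1.trans (le_of_eq ?_)
    ring
  exact ⟨hmain, _, Set.forall_mem_range.2 fun T => (hmain T).2⟩
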